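/- Let $1\le H\le n$ be integers and let $a_0,\dots,a_n\ge 0$ be real numbers with $\sum_{i=0}^n a_i=1$ (and $a_i=0$ for $i>n$). Put $b_H=a_0+\dots+a_H$ and $a'_{H-1}=a_0+\dots+a_{H-1}$, and consider the discrete-time Markov chain on the states $0,1,2,\dots$ with the lumped transition matrix $P'=(p_{i,j})_{i,j\ge 0}$, $$P'=\begin{bmatrix} b_H & a_{H+1} & a_{H+2} & \dots & a_n & 0 & \dots\\ a'_{H-1} & a_H & a_{H+1} & \dots & a_{n-1} & a_n & \dots\\ 0 & a'_{H-1} & a_H & a_{H+1} & \dots & a_{n-1} & \dots\\ 0&0&a'_{H-1}&a_H&\dots\\ \vdots&\vdots&&\ddots&\ddots\end{bmatrix},$$ that is, $p_{0,0}=b_H$, $p_{i,i-1}=a'_{H-1}$ and $p_{i,i}=a_H$ for $i\ge1$, $p_{i,i+h}=a_{H+h}$ for $i\ge 0$, $h\ge 1$, and all other entries $0$. Assume $a_n\ne 0$ and $a'_{H-1}\neq 0$. Renumber the coefficients so that the chain has the form $H=1$: put $m=n-H+1$ and $$\alpha_0=1,\qquad \alpha_j=\frac{a_{H+j-1}}{a'_{H-1}}\quad(j\ge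 1)$$ (so $\alpha_j=a_j/a_0$ and $m=n$ if $H=1$). Assume that the $m\times m$ companion matrix $$W=\begin{bmatrix}0&1&0&\dots&0\\ 0&0&1&\dots&0\\ \vdots&&&\ddots&\vdots\\ 0&0&0&\dots&1\\ -\alpha_m&-\alpha_{m-1}&\dots&-\alpha_2&1+\sum_{j=2}^m\alpha_j\end{bmatrix}$$ has $m$ distinct complex eigenvalues. Then there is a limiting distribution $\pi=(\pi^{(0)},\pi^{(1)},\dots)$ with $\pi^{(j)}\ge 0$: for every initial probability distribution $\pi_0$ on $\{0,1,2,\dots\}$ the laws $\pi_k=\pi_0(P')^k$ satisfy $\lim_{k\to\infty}\pi_k^{(j)}=\pi^{(j)}$ for all $j\ge 0$. It is given by $$\pi^{(0)}=\max\Big\{1-\sum_{j=2}^m (j-1)\alpha_j,\,0\Big\},\qquad \pi^{(1)}=\sum_{j=2}^m\alpha_j\,\pi^{(0)},$$ $$\pi^{(l)}=\Big(1+\sum_{j=2}^m\alpha_j\Big)\pi^{(l-1)}-\sum_{j=2}^{\min(m,l)}\alpha_j\,\pi^{(l-j)}\qquad (l>1).$$ If $\sum_{j=2}^m (j-1)\alpha_j<1$,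 then $\sum_{j\ge 0}\pi^{(j)}=1$; otherwise $\pi^{(j)}=0$ for all $j$. -/

import Mathlib

open Filter Topology

noncomputable section

namespace QBDP

/-- The lumped transition matrix, with rows and columns indexed by the states `0, 1, 2, …`:
row `0` is `b_H, a_{H+1}, a_{H+2}, …` with `b_H = a_0 + ⋯ + a_H`, and row `i ≥ 1` has
`a'_{H-1} = a_0 + ⋯ + a_{H-1}` in column `i - 1`, `a_{H+h}` in column `i + h` for `h ≥ 0`,
and `0` elsewhere. -/
def lumpedMatrix (a : ℕ → ℝ) (H : ℕ) : Matrix ℕ ℕ ℝ := fun i j =>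
  if i = 0 ∧ j = 0 then ∑ q ∈ Finset.range (H + 1), a q
  else if j + 1 = i then ∑ q ∈ Finset.range H, a q
  else if i ≤ j then a (H + (j - i))
  else 0

/-- The law at time `k` of the chain with transition matrix `P` and initial law `ν`:
the row vector `ν P ^ k`. -/
def law (P : Matrix ℕ ℕ ℝ) (ν : ℕ → ℝ) : ℕ → ℕ → ℝ
  | 0 => ν
  | k + 1 => fun j => ∑' i, law P ν k i * P i j

/-- The coefficients of the lumped chain, renumbered so that it has the form `H = 1`:
the aggregate probability `a'_{H-1}` of a step to the left gets the index `0`, and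
`a_H, a_{H+1}, …` get the indices `1, 2, …`. For `H = 1` this is `a` itself. -/
def lumpedCoeff (a : ℕ → ℝ) (H : ℕ) : ℕ → ℝ
  | 0 => ∑ q ∈ Finset.range H, a q
  | j + 1 => a (H + j)

/-- The ratios `α_j = a_j / a_0`, for the renumbered coefficients of the lumped chain. -/
def alpha (a : ℕ → ℝ) (H : ℕ) (j : ℕ) : ℝ := lumpedCoeff a H j / lumpedCoeff a H 0

/-- `γ(k, l) = ∑_{j = 0}^{k} α_j l ^ (k - j)`. -/
def gammaFn (α : ℕ → ℝ) (k : ℕ) (l : ℝ) : ℝ := ∑ j ∈ Finset.range (k + 1), α j * l ^ (k - j)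

/-- The `n × n` companion matrix `W`: ones on the superdiagonal, and last row
`-α_n, -α_{n-1}, …, -α_1` in which the entry of index `H` is replaced by
`w = γ(H - 1, 1) + ∑_{j = H + 1}^{n} α_j`. -/
def matW (n H : ℕ) (α : ℕ → ℝ) : Matrix (Fin n) (Fin n) ℝ := fun r c =>
  if (r : ℕ) + 1 = n then
    if n - (c : ℕ) = H then gammaFn α (H - 1) 1 + ∑ j ∈ Finset.Icc (H + 1) n, α j
    else -α (n - (c : ℕ))
  else if (c : ℕ) = (r : ℕ) + 1 then 1
  else 0

/-- The complex eigenvalues of a real square matrix are pairwise distinct, i.e. all of them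
have algebraic multiplicity one. -/
def DistinctEigenvalues {n : ℕ} (M : Matrix (Fin n) (Fin n) ℝ) : Prop :=
  (M.map (algebraMap ℝ ℂ)).charpoly.roots.Nodup

end QBDP

end

/-! The chain is the reflected walk `x ↦ max (x + ξ - 1) 0` with `ξ` distributed as the renumbered
coefficients `c`. Its distribution functions evolve by the monotone linear operator `lindley c`, so
convergence of laws becomes comparison of iterates.

Starting from the constant `1` (all mass at state `0`), the iterates decrease to a fixed point `D`.
A fixed point is determined by its value at `0`, and one with limit `M` satisfies `M * (1 - drift) =
c 0 * D 0`, where the drift is `∑ q * c q` (`fixedPoint_limit`).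

If the drift is at least `1`, this forces `D = 0`, and every start is squeezed between `0` and the
iterates of `1`. If it is below `1`, shifted geometric laws are subsolutions; their iterates
increase to a fixed point of total mass `1`, necessarily `D`. Any starting distribution function
dominates `r` times such a subsolution for each `r < 1`, which gives the lower bound. The increments
of `D` are then `π`. -/

/-- The distribution function after one step of the walk `x ↦ max (x + ξ - 1) 0`, where `ξ` has
law `c`, in terms of the distribution function `F` before the step. -/
def lindley (c F : ℕ → ℝ) (j : ℕ) : ℝ := ∑ q ∈ Finset.range (j + 2), c q * F (j + 1 - q)

/-! ### The one-step operator and its fixed points -/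

section Lindley

variable {c : ℕ → ℝ}

theorem lindley_mono (hc : ∀ q, 0 ≤ c q) : Monotone (lindley c) := fun _ _ h _ =>
  Finset.sum_le_sum fun q _ => mul_le_mul_of_nonneg_left (h _) (hc q)

theorem lindley_const_mul (r : ℝ) (F : ℕ → ℝ) :
    lindley c (fun j => r * F j) = fun j => r * lindley c F j := by
  funext j
  simp only [lindley, Finset.mul_sum]
  exact Finset.sum_congr rfl fun q _ => by ring

theorem iterate_lindley_const_mul (r : ℝ) (F : ℕ → ℝ) (k : ℕ) :
    (lindley c)^[k] (fun j => r * F j) = fun j => r * (lindley c)^[k] F j := by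
  induction k with
  | zero => rfl
  | succ k ih => rw [Function.iterate_succ_apply', ih, lindley_const_mul,
      Function.iterate_succ_apply']

theorem lindley_eq_of_tendsto_iterate {F D : ℕ → ℝ}
    (h : ∀ j, Tendsto (fun k => (lindley c)^[k] F j) atTop (𝓝 (D j))) : lindley c D = D := by
  funext j
  have h1 : Tendsto (fun k => lindley c ((lindley c)^[k] F) j) atTop (𝓝 (lindley c D j)) :=
    tendsto_finsetSum _ fun q _ => (h _).const_mul (c q)
  have h2 : Tendsto (fun k => (lindley c)^[k + 1] F j) atTop (𝓝 (D j)) :=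
    (h j).comp (tendsto_add_atTop_nat 1)
  simp only [Function.iterate_succ_apply'] at h2
  exact tendsto_nhds_unique h1 h2

/-- Since `c 0 ≠ 0`, the equation at `j` can be solved for the value at `j + 1`. -/
theorem fixedPoint_ext (hc0 : c 0 ≠ 0) {D E : ℕ → ℝ} (hD : lindley c D = D)
    (hE : lindley c E = E) (h0 : D 0 = E 0) : D = E := by
  funext j
  induction j using Nat.strong_induction_on with
  | _ j ih =>
    cases j with
    | zero => exact h0
    | succ j =>
      have h1 := congrFun hD j
      have h2 := congrFun hE j
      rw [lindley, Finset.sum_range_succ'] at h1 h2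
      have h3 : ∑ q ∈ Finset.range (j + 1), c (q + 1) * D (j + 1 - (q + 1))
          = ∑ q ∈ Finset.range (j + 1), c (q + 1) * E (j + 1 - (q + 1)) :=
        Finset.sum_congr rfl fun q _ => by rw [ih _ (by omega)]
      rw [h3, ih j (by omega)] at h1
      simp only [Nat.sub_zero] at h1 h2
      exact mul_left_cancel₀ hc0 (by linarith)

theorem lindley_one_le {m : ℕ} (hc : ∀ q, 0 ≤ c q) (hm : ∀ q, m < q → c q = 0)
    (hsum : ∑ q ∈ Finset.range (m + 1), c q = 1) : lindley c (fun _ => 1) ≤ fun _ => 1 := by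
  intro j
  simp only [lindley, mul_one]
  rw [← hsum]
  rcases le_total (j + 2) (m + 1) with h | h
  · exact Finset.sum_le_sum_of_subset_of_nonneg (Finset.range_mono h) fun q _ _ => hc q
  · refine (Finset.sum_subset (Finset.range_mono h) fun q _ hq => hm q ?_).ge
    simpa using hq

/-! ### Mass balance for fixed points -/

theorem tendsto_partialSum_sub {D : ℕ → ℝ} {M : ℝ} (h : Tendsto D atTop (𝓝 M)) (q : ℕ) :
    Tendsto (fun N => ∑ i ∈ Finset.range N, D i - ∑ i ∈ Finset.range (N - q), D i) atTop
      (𝓝 (q * M)) := by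
  induction q with
  | zero => simp
  | succ q ih =>
    have h1 := ih.add (h.comp (tendsto_sub_atTop_nat (q + 1)))
    have h2 : (q : ℝ) * M + M = ((q + 1 : ℕ) : ℝ) * M := by push_cast; ring
    rw [h2] at h1
    refine h1.congr' ?_
    filter_upwards [eventually_ge_atTop (q + 1)] with N hN
    have h3 : N - q = N - (q + 1) + 1 := by omega
    simp only [Function.comp_apply]
    rw [h3, Finset.sum_range_succ]
    ring

/-- Sums the fixed-point equation over `j < N`. The term `q = 0` only meets `D 1, …, D N`, hence the
correction `c 0 * D 0`. -/
theorem sum_mul_partialSum_fixedPoint {D : ℕ → ℝ} (hD : lindley c D = D) (N : ℕ) :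
    ∑ q ∈ Finset.range (N + 1), c q * ∑ i ∈ Finset.range (N + 1 - q), D i
      = ∑ i ∈ Finset.range N, D i + c 0 * D 0 := by
  induction N with
  | zero => simp
  | succ N ih =>
    have h1 : ∑ q ∈ Finset.range (N + 1 + 1), c q * ∑ i ∈ Finset.range (N + 1 + 1 - q), D i
        = ∑ q ∈ Finset.range (N + 1 + 1), c q * ∑ i ∈ Finset.range (N + 1 - q), D i
          + lindley c D N := by
      rw [lindley, ← Finset.sum_add_distrib]
      refine Finset.sum_congr rfl fun q hq => ?_
      have : N + 1 + 1 - q = N + 1 - q + 1 := by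
        have := Finset.mem_range.1 hq
        omega
      rw [this, Finset.sum_range_succ, mul_add]
    rw [h1, hD, Finset.sum_range_succ _ (N + 1), ih, Finset.sum_range_succ _ N]
    simp
    ring

/-- The total mass `M` of an invariant measure in terms of its mass at `0`. -/
theorem fixedPoint_limit {m : ℕ} (hm : ∀ q, m < q → c q = 0)
    (hsum : ∑ q ∈ Finset.range (m + 1), c q = 1) {D : ℕ → ℝ} (hD : lindley c D = D) {M : ℝ}
    (hM : Tendsto D atTop (𝓝 M)) :
    M * (1 - ∑ q ∈ Finset.range (m + 1), q * c q) = c 0 * D 0 := by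
  have h1 : Tendsto (fun N => ∑ q ∈ Finset.range (m + 1), c q *
      (∑ i ∈ Finset.range (N + 1), D i - ∑ i ∈ Finset.range (N + 1 - q), D i)) atTop
      (𝓝 (∑ q ∈ Finset.range (m + 1), c q * (q * M))) :=
    tendsto_finsetSum _ fun q _ =>
      ((tendsto_partialSum_sub hM q).comp (tendsto_add_atTop_nat 1)).const_mul (c q)
  have h2 : Tendsto (fun N => D N - c 0 * D 0) atTop
      (𝓝 (∑ q ∈ Finset.range (m + 1), c q * (q * M))) := by
    refine h1.congr' ?_
    filter_upwards [eventually_ge_atTop m] with N hN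
    have h3 := sum_mul_partialSum_fixedPoint hD N
    have h4 : ∑ q ∈ Finset.range (m + 1), c q * ∑ i ∈ Finset.range (N + 1 - q), D i
        = ∑ q ∈ Finset.range (N + 1), c q * ∑ i ∈ Finset.range (N + 1 - q), D i := by
      refine Finset.sum_subset (Finset.range_mono (by omega)) fun q _ hq => ?_
      rw [hm q (by simpa using hq), zero_mul]
    simp only [mul_sub, Finset.sum_sub_distrib]
    rw [← Finset.sum_mul, hsum, h4, h3, Finset.sum_range_succ]
    ring
  have h5 := tendsto_nhds_unique h2 (hM.sub_const _)
  have h6 : ∑ q ∈ Finset.range (m + 1), c q * (q * M)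
      = M * ∑ q ∈ Finset.range (m + 1), q * c q := by
    rw [Finset.mul_sum]
    exact Finset.sum_congr rfl fun q _ => by ring
  rw [h6] at h5
  linarith

/-! ### Geometric subsolutions -/

/-- Under negative drift the generating function of `c` lies below the diagonal somewhere to the
right of `1`. -/
theorem exists_genFun_le {m : ℕ} (hsum : ∑ q ∈ Finset.range (m + 1), c q = 1)
    (hdrift : ∑ q ∈ Finset.range (m + 1), q * c q < 1) :
    ∃ w : ℝ, 1 < w ∧ ∑ q ∈ Finset.range (m + 1), c q * w ^ q ≤ w := by
  -- The function vanishes at `1`, and its derivative there is the drift minus `1`.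
  have hd : HasDerivAt (fun w : ℝ => ∑ q ∈ Finset.range (m + 1), c q * w ^ q - w)
      (∑ q ∈ Finset.range (m + 1), c q * (q * 1 ^ (q - 1)) - 1) 1 :=
    (HasDerivAt.fun_sum fun q _ => (hasDerivAt_pow q (1 : ℝ)).const_mul (c q)).sub
      (hasDerivAt_id 1)
  have hneg : ∑ q ∈ Finset.range (m + 1), c q * ((q : ℝ) * 1 ^ (q - 1)) - 1 < 0 := by
    simp only [one_pow, mul_one, mul_comm (c _)]
    linarith
  have h1 : ∀ᶠ w in 𝓝[>] (1 : ℝ),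
      slope (fun w : ℝ => ∑ q ∈ Finset.range (m + 1), c q * w ^ q - w) 1 w < 0 :=
    ((hasDerivAt_iff_tendsto_slope.1 hd).mono_left
      (nhdsWithin_mono _ fun w hw => ne_of_gt hw)).eventually (gt_mem_nhds hneg)
  obtain ⟨w, hw, hw1⟩ := (h1.and self_mem_nhdsWithin).exists
  have hw1 : 1 < w := hw1
  refine ⟨w, hw1, ?_⟩
  rw [slope_def_field] at hw
  have h2 := (div_neg_iff.1 hw).resolve_left fun h => by linarith [h.2]
  simp only [one_pow, mul_one, hsum] at h2
  linarith [h2.1]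

/-- The distribution function of a geometric law shifted to the right by `s`. -/
noncomputable def shiftedGeometric (w : ℝ) (s j : ℕ) : ℝ := if j < s then 0 else 1 - w ^ s / w ^ j

theorem shiftedGeometric_le_one {w : ℝ} (hw : 1 < w) (s j : ℕ) : shiftedGeometric w s j ≤ 1 := by
  unfold shiftedGeometric
  split_ifs
  · exact zero_le_one
  · have : 0 ≤ w ^ s / w ^ j := by positivity
    linarith

theorem le_shiftedGeometric {w : ℝ} (hw : 1 < w) (s j : ℕ) :
    1 - w ^ s / w ^ j ≤ shiftedGeometric w s j := by
  unfold shiftedGeometric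
  split_ifs with h
  · have : 1 ≤ w ^ s / w ^ j := by
      rw [one_le_div (by positivity)]
      exact pow_le_pow_right₀ hw.le h.le
    linarith
  · exact le_rfl

theorem shiftedGeometric_nonneg {w : ℝ} (hw : 1 < w) (s j : ℕ) :
    0 ≤ shiftedGeometric w s j := by
  unfold shiftedGeometric
  split_ifs with h
  · exact le_rfl
  · rw [sub_nonneg, div_le_one (by positivity)]
    exact pow_le_pow_right₀ hw.le (not_lt.1 h)

theorem tendsto_shiftedGeometric {w : ℝ} (hw : 1 < w) (s : ℕ) :
    Tendsto (shiftedGeometric w s) atTop (𝓝 1) := by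
  have h1 : Tendsto (fun j => 1 - w ^ s / w ^ j) atTop (𝓝 (1 - 0)) :=
    ((tendsto_pow_atTop_atTop_of_one_lt hw).const_div_atTop (w ^ s)).const_sub 1
  rw [sub_zero] at h1
  exact tendsto_of_tendsto_of_tendsto_of_le_of_le h1 tendsto_const_nhds
    (le_shiftedGeometric hw s) (shiftedGeometric_le_one hw s)

/-- On the unclipped profile `1 - w ^ s / w ^ j` the step acts through the generating function at
`w`, and clipping at `0` only increases the result. The condition `m ≤ s` ensures that for `j ≥ s`
no jump is cut off by the boundary. -/
theorem shiftedGeometric_le_lindley {m : ℕ} (hc : ∀ q, 0 ≤ c q) (hm : ∀ q, m < q → c q = 0)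
    (hsum : ∑ q ∈ Finset.range (m + 1), c q = 1) {w : ℝ} (hw : 1 < w)
    (hgen : ∑ q ∈ Finset.range (m + 1), c q * w ^ q ≤ w) {s : ℕ} (hs : m ≤ s) :
    shiftedGeometric w s ≤ lindley c (shiftedGeometric w s) := by
  intro j
  by_cases h : j < s
  · rw [shiftedGeometric, if_pos h]
    exact Finset.sum_nonneg fun q _ => mul_nonneg (hc q) (shiftedGeometric_nonneg hw s _)
  have hw0 : w ≠ 0 := by positivity
  rw [shiftedGeometric, if_neg h]
  calc 1 - w ^ s / w ^ j
      ≤ 1 - w ^ s / w ^ (j + 1) * ∑ q ∈ Finset.range (m + 1), c q * w ^ q := by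
        have h1 : w ^ s / w ^ (j + 1) * ∑ q ∈ Finset.range (m + 1), c q * w ^ q
            ≤ w ^ s / w ^ (j + 1) * w := mul_le_mul_of_nonneg_left hgen (by positivity)
        have h2 : w ^ s / w ^ (j + 1) * w = w ^ s / w ^ j := by
          rw [pow_succ]
          field_simp
        linarith
    _ = ∑ q ∈ Finset.range (m + 1), c q * (1 - w ^ s / w ^ (j + 1 - q)) := by
        simp only [mul_sub, mul_one, Finset.sum_sub_distrib, hsum, Finset.mul_sum]
        congr 1
        refine Finset.sum_congr rfl fun q hq => ?_
        have hq' : q ≤ j + 1 := by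
          have := Finset.mem_range.1 hq
          omega
        have : w ^ (j + 1) = w ^ (j + 1 - q) * w ^ q := by rw [← pow_add, Nat.sub_add_cancel hq']
        rw [this]
        field_simp
    _ ≤ ∑ q ∈ Finset.range (m + 1), c q * shiftedGeometric w s (j + 1 - q) :=
        Finset.sum_le_sum fun q _ => mul_le_mul_of_nonneg_left (le_shiftedGeometric hw s _) (hc q)
    _ = lindley c (shiftedGeometric w s) j := by
        refine Finset.sum_subset (Finset.range_mono (by omega)) fun q _ hq => ?_
        rw [hm q (by simpa using hq), zero_mul]

/-! ### Monotone iteration and convergence -/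

theorem iterate_lindley_mono (hc : ∀ q, 0 ≤ c q) (k : ℕ) : Monotone (lindley c)^[k] :=
  (lindley_mono hc).iterate k

theorem iterate_lindley_one_nonneg (hc : ∀ q, 0 ≤ c q) (k : ℕ) :
    0 ≤ (lindley c)^[k] (fun _ => 1) := by
  have h : (lindley c)^[k] (fun _ => 0) = fun _ => 0 := by
    simpa using iterate_lindley_const_mul (c := c) 0 (fun _ => 1) k
  calc (0 : ℕ → ℝ) = (lindley c)^[k] (fun _ => 0) := h.symm
    _ ≤ _ := iterate_lindley_mono hc k fun _ => zero_le_one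

theorem iterate_lindley_one_le {m : ℕ} (hc : ∀ q, 0 ≤ c q) (hm : ∀ q, m < q → c q = 0)
    (hsum : ∑ q ∈ Finset.range (m + 1), c q = 1) (k : ℕ) :
    (lindley c)^[k] (fun _ => 1) ≤ fun _ => 1 := by
  induction k with
  | zero => exact le_rfl
  | succ k ih =>
    rw [Function.iterate_succ_apply]
    exact (iterate_lindley_mono hc k (lindley_one_le hc hm hsum)).trans ih

theorem monotone_lindley (hc : ∀ q, 0 ≤ c q) {F : ℕ → ℝ} (hF : Monotone F) (hF0 : 0 ≤ F) :
    Monotone (lindley c F) := by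
  refine monotone_nat_of_le_succ fun j => ?_
  rw [lindley, lindley, Finset.sum_range_succ _ (j + 2)]
  have h1 : 0 ≤ c (j + 2) * F (j + 1 + 1 - (j + 2)) := mul_nonneg (hc _) (hF0 _)
  have h2 : ∑ q ∈ Finset.range (j + 2), c q * F (j + 1 - q)
      ≤ ∑ q ∈ Finset.range (j + 2), c q * F (j + 1 + 1 - q) :=
    Finset.sum_le_sum fun q _ => mul_le_mul_of_nonneg_left (hF (by omega)) (hc q)
  linarith

theorem monotone_iterate_lindley_one (hc : ∀ q, 0 ≤ c q) (k : ℕ) :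
    Monotone ((lindley c)^[k] (fun _ => 1)) := by
  induction k with
  | zero => exact monotone_const
  | succ k ih =>
    rw [Function.iterate_succ_apply']
    exact monotone_lindley hc ih (iterate_lindley_one_nonneg hc k)

theorem exists_limit_iterate_lindley_one {m : ℕ} (hc : ∀ q, 0 ≤ c q) (hm : ∀ q, m < q → c q = 0)
    (hsum : ∑ q ∈ Finset.range (m + 1), c q = 1) :
    ∃ D : ℕ → ℝ, (∀ j, Tendsto (fun k => (lindley c)^[k] (fun _ => 1) j) atTop (𝓝 (D j))) ∧
      lindley c D = D ∧ Monotone D ∧ 0 ≤ D ∧ D ≤ fun _ => 1 := by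
  have hanti : ∀ j, Antitone fun k => (lindley c)^[k] (fun _ => 1) j := fun j =>
    antitone_nat_of_succ_le fun k => by
      rw [Function.iterate_succ_apply]
      exact iterate_lindley_mono hc k (lindley_one_le hc hm hsum) j
  have hlim : ∀ j, Tendsto (fun k => (lindley c)^[k] (fun _ => 1) j) atTop
      (𝓝 (⨅ k, (lindley c)^[k] (fun _ => 1) j)) := fun j =>
    tendsto_atTop_ciInf (hanti j)
      ⟨0, by rintro _ ⟨k, rfl⟩; exact iterate_lindley_one_nonneg hc k j⟩
  exact ⟨_, hlim, lindley_eq_of_tendsto_iterate hlim,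
    fun i j hij => le_of_tendsto_of_tendsto' (hlim i) (hlim j)
      fun k => monotone_iterate_lindley_one hc k hij,
    fun j => ge_of_tendsto' (hlim j) fun k => iterate_lindley_one_nonneg hc k j,
    fun j => le_of_tendsto' (hlim j) fun k => iterate_lindley_one_le hc hm hsum k j⟩

theorem exists_limit_iterate_subsolution {m : ℕ} (hc : ∀ q, 0 ≤ c q) (hm : ∀ q, m < q → c q = 0)
    (hsum : ∑ q ∈ Finset.range (m + 1), c q = 1) {G : ℕ → ℝ} (hG : G ≤ lindley c G)
    (hG1 : G ≤ fun _ => 1) (hGlim : Tendsto G atTop (𝓝 1)) :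
    ∃ D : ℕ → ℝ, (∀ j, Tendsto (fun k => (lindley c)^[k] G j) atTop (𝓝 (D j))) ∧
      lindley c D = D ∧ Tendsto D atTop (𝓝 1) := by
  have hmono : ∀ j, Monotone fun k => (lindley c)^[k] G j := fun j =>
    monotone_nat_of_le_succ fun k => by
      rw [Function.iterate_succ_apply]
      exact iterate_lindley_mono hc k hG j
  have hle : ∀ k j, (lindley c)^[k] G j ≤ 1 := fun k j =>
    (iterate_lindley_mono hc k hG1 j).trans (iterate_lindley_one_le hc hm hsum k j)
  have hlim : ∀ j, Tendsto (fun k => (lindley c)^[k] G j) atTop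
      (𝓝 (⨆ k, (lindley c)^[k] G j)) := fun j =>
    tendsto_atTop_ciSup (hmono j) ⟨1, by rintro _ ⟨k, rfl⟩; exact hle k j⟩
  exact ⟨_, hlim, lindley_eq_of_tendsto_iterate hlim,
    tendsto_of_tendsto_of_tendsto_of_le_of_le hGlim tendsto_const_nhds
      (fun j => (hmono j).ge_of_tendsto (hlim j) 0)
      (fun j => le_of_tendsto' (hlim j) fun k => hle k j)⟩

theorem fixedPoint_unique_of_tendsto_one {m : ℕ} (hc0 : c 0 ≠ 0) (hm : ∀ q, m < q → c q = 0)
    (hsum : ∑ q ∈ Finset.range (m + 1), c q = 1) {D E : ℕ → ℝ} (hD : lindley c D = D)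
    (hE : lindley c E = E) (hD1 : Tendsto D atTop (𝓝 1)) (hE1 : Tendsto E atTop (𝓝 1)) :
    D = E :=
  fixedPoint_ext hc0 hD hE <| mul_left_cancel₀ hc0 <|
    (fixedPoint_limit hm hsum hD hD1).symm.trans (fixedPoint_limit hm hsum hE hE1)

/-- Convergence of the distribution functions of the reflected walk, with the mass that its limit
puts on `0` and the total mass of the limit. -/
theorem exists_limit_iterate_lindley {m : ℕ} (hc : ∀ q, 0 ≤ c q) (hc0 : c 0 ≠ 0)
    (hm : ∀ q, m < q → c q = 0) (hsum : ∑ q ∈ Finset.range (m + 1), c q = 1) :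
    ∃ D : ℕ → ℝ, lindley c D = D ∧ Monotone D ∧ 0 ≤ D ∧
      c 0 * D 0 = max (1 - ∑ q ∈ Finset.range (m + 1), q * c q) 0 ∧
      (∑ q ∈ Finset.range (m + 1), q * c q < 1 → Tendsto D atTop (𝓝 1)) ∧
      (1 ≤ ∑ q ∈ Finset.range (m + 1), q * c q → D = 0) ∧
      ∀ F : ℕ → ℝ, 0 ≤ F → (F ≤ fun _ => 1) → Tendsto F atTop (𝓝 1) →
        ∀ j, Tendsto (fun k => (lindley c)^[k] F j) atTop (𝓝 (D j)) := by
  obtain ⟨D, hlim, hfix, hmono, hD0, hD1⟩ := exists_limit_iterate_lindley_one hc hm hsum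
  rcases lt_or_ge (∑ q ∈ Finset.range (m + 1), q * c q) 1 with hρ | hρ
  · obtain ⟨w, hw, hgen⟩ := exists_genFun_le hsum hρ
    have hsub := fun s (hs : m ≤ s) => shiftedGeometric_le_lindley hc hm hsum hw hgen hs
    have hDlim : Tendsto D atTop (𝓝 1) := by
      obtain ⟨E, hE, -, hE1⟩ := exists_limit_iterate_subsolution hc hm hsum (hsub m le_rfl)
        (shiftedGeometric_le_one hw m) (tendsto_shiftedGeometric hw m)
      refine tendsto_of_tendsto_of_tendsto_of_le_of_le hE1 tendsto_const_nhds (fun j => ?_) hD1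
      exact le_of_tendsto_of_tendsto' (hE j) (hlim j) fun k =>
        iterate_lindley_mono hc k (shiftedGeometric_le_one hw m) j
    refine ⟨D, hfix, hmono, hD0, ?_, fun _ => hDlim, fun h => absurd h (not_le.2 hρ), ?_⟩
    · rw [← fixedPoint_limit hm hsum hfix hDlim, one_mul, max_eq_left (by linarith)]
    intro F hF0 hF1 hFlim j
    rw [tendsto_order]
    refine ⟨fun b hb => ?_, fun b hb => ?_⟩
    -- `F` need not dominate any shifted geometric law, but beyond some `s` it exceeds `r < 1`, so a
    -- scaled one fits below it.
    · obtain ⟨r, hr0, hr1, hrb⟩ : ∃ r : ℝ, 0 ≤ r ∧ r < 1 ∧ b < r * D j := by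
        have h1 : Tendsto (fun r : ℝ => r * D j) (𝓝[<] 1) (𝓝 (1 * D j)) :=
          ((continuous_id.mul continuous_const).tendsto (1 : ℝ)).mono_left nhdsWithin_le_nhds
        rw [one_mul] at h1
        obtain ⟨r, ⟨hr, hr0⟩, hr1⟩ := (((h1.eventually (lt_mem_nhds hb)).and
          (nhdsWithin_le_nhds (lt_mem_nhds (zero_lt_one' ℝ)))).and self_mem_nhdsWithin).exists
        exact ⟨r, le_of_lt hr0, hr1, hr⟩
      obtain ⟨s, hs⟩ := eventually_atTop.1 (hFlim.eventually (lt_mem_nhds hr1))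
      obtain ⟨E, hE, hEfix, hE1⟩ := exists_limit_iterate_subsolution hc hm hsum
        (hsub (max m s) (le_max_left _ _)) (shiftedGeometric_le_one hw _)
        (tendsto_shiftedGeometric hw _)
      -- The limit does not depend on the shift, so `s` may be chosen after `r`.
      rw [fixedPoint_unique_of_tendsto_one hc0 hm hsum hfix hEfix hDlim hE1] at hrb
      have hle : (fun i => r * shiftedGeometric w (max m s) i) ≤ F := fun i => by
        by_cases hi : i < max m s
        · simpa [shiftedGeometric, hi] using hF0 i
        · calc r * shiftedGeometric w (max m s) i ≤ r * 1 :=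
                mul_le_mul_of_nonneg_left (shiftedGeometric_le_one hw _ _) hr0
            _ ≤ F i := by
                rw [mul_one]
                exact (hs i ((le_max_right _ _).trans (not_lt.1 hi))).le
      filter_upwards [((hE j).const_mul r).eventually (lt_mem_nhds hrb)] with k hk
      have h2 := iterate_lindley_mono hc k hle j
      rw [iterate_lindley_const_mul] at h2
      exact hk.trans_le h2
    · filter_upwards [(hlim j).eventually (gt_mem_nhds hb)] with k hk
      exact (iterate_lindley_mono hc k hF1 j).trans_lt hk
  -- Mass balance equates `c 0 * D 0` with a nonnegative mass times a nonpositive factor.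
  · have hD00 : D 0 = 0 := by
      have h1 : Tendsto D atTop (𝓝 (⨆ j, D j)) :=
        tendsto_atTop_ciSup hmono ⟨1, by rintro _ ⟨j, rfl⟩; exact hD1 j⟩
      have h2 := fixedPoint_limit hm hsum hfix h1
      have h3 : 0 ≤ ⨆ j, D j := Real.iSup_nonneg hD0
      have h4 : c 0 * D 0 ≤ 0 := by
        rw [← h2]
        exact mul_nonpos_of_nonneg_of_nonpos h3 (by linarith)
      have h5 : 0 < c 0 := lt_of_le_of_ne (hc 0) hc0.symm
      exact le_antisymm (nonpos_of_mul_nonpos_right h4 h5) (hD0 0)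
    have hDz : D = 0 := fixedPoint_ext hc0 hfix (by funext j; simp [lindley]) hD00
    refine ⟨D, hfix, hmono, hD0, ?_, fun h => absurd h (not_lt.2 hρ), fun _ => hDz, ?_⟩
    · rw [hD00, mul_zero, max_eq_right (by linarith)]
    intro F hF0 hF1 _ j
    refine tendsto_of_tendsto_of_tendsto_of_le_of_le tendsto_const_nhds (hlim j) (fun k => ?_)
      (fun k => iterate_lindley_mono hc k hF1 j)
    have h : (lindley c)^[k] (fun _ => 0) = fun _ => 0 := by
      simpa using iterate_lindley_const_mul (c := c) 0 (fun _ => 1) k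
    have h2 := iterate_lindley_mono hc k (show (fun _ => (0 : ℝ)) ≤ F from hF0) j
    rw [h] at h2
    rwa [hDz]

end Lindley

theorem sum_range_succ_eq_add_sum_Icc (f : ℕ → ℝ) {m : ℕ} (hm : 1 ≤ m) :
    ∑ q ∈ Finset.range (m + 1), f q = f 0 + f 1 + ∑ q ∈ Finset.Icc 2 m, f q := by
  obtain ⟨m, rfl⟩ : ∃ k, m = k + 1 := ⟨m - 1, by omega⟩
  rw [Finset.range_eq_Ico, Finset.sum_eq_sum_Ico_succ_bot (by omega),
    Finset.sum_eq_sum_Ico_succ_bot (by omega), ← add_assoc]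
  rfl

/-- The recursion for the increments of a fixed point `D`, with `D` itself at `0`. -/
theorem fixedPoint_increment {c D : ℕ → ℝ} (hD : lindley c D = D) (l : ℕ) :
    D (l + 1) - D l = ∑ q ∈ Finset.range (l + 2), c q * (D (l + 2 - q) - D (l + 1 - q))
      + c (l + 2) * D 0 := by
  have h1 := congrFun hD (l + 1)
  have h2 := congrFun hD l
  rw [← h1, ← h2, lindley, lindley, Finset.sum_range_succ _ (l + 2)]
  simp only [mul_sub, Finset.sum_sub_distrib, Nat.sub_self]
  ring

/-! ### From the transition matrix to the operator -/

section Chain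

variable {a : ℕ → ℝ} {H : ℕ}

theorem lumpedMatrix_eq_zero {i j : ℕ} (h : j + 1 < i) : QBDP.lumpedMatrix a H i j = 0 := by
  simp only [QBDP.lumpedMatrix]
  rw [if_neg (by omega), if_neg (by omega), if_neg (by omega)]

theorem lumpedMatrix_zero_zero :
    QBDP.lumpedMatrix a H 0 0 = QBDP.lumpedCoeff a H 0 + QBDP.lumpedCoeff a H 1 := by
  simp [QBDP.lumpedMatrix, QBDP.lumpedCoeff, Finset.sum_range_succ]

theorem lumpedMatrix_apply {i j : ℕ} (h : i ≤ j + 1) (h0 : ¬(i = 0 ∧ j = 0)) :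
    QBDP.lumpedMatrix a H i j = QBDP.lumpedCoeff a H (j + 1 - i) := by
  simp only [QBDP.lumpedMatrix]
  rw [if_neg h0]
  split_ifs with h1 h2
  · subst h1
    simp [QBDP.lumpedCoeff]
  · rw [show j + 1 - i = j - i + 1 by omega, QBDP.lumpedCoeff]
  · omega

theorem law_succ (ν : ℕ → ℝ) (k j : ℕ) :
    QBDP.law (QBDP.lumpedMatrix a H) ν (k + 1) j = ∑ i ∈ Finset.range (j + 2),
      QBDP.law (QBDP.lumpedMatrix a H) ν k i * QBDP.lumpedMatrix a H i j := by
  refine tsum_eq_sum fun i hi => ?_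
  rw [lumpedMatrix_eq_zero (not_lt.1 (mt Finset.mem_range.2 hi)), mul_zero]

/-- Away from the corner, entries depend only on `j + 1 - i`, so column `j + 1` supplies the
increment of the convolution. The corner entry `c 0 + c 1` is the reflection at `0`. -/
theorem sum_law_succ (ν : ℕ → ℝ) (k j : ℕ) :
    ∑ i ∈ Finset.range (j + 1), QBDP.law (QBDP.lumpedMatrix a H) ν (k + 1) i
      = lindley (QBDP.lumpedCoeff a H)
        (fun j => ∑ i ∈ Finset.range (j + 1), QBDP.law (QBDP.lumpedMatrix a H) ν k i) j := by
  induction j with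
  | zero =>
    rw [zero_add, Finset.sum_range_one, law_succ]
    simp only [lindley, Finset.sum_range_succ, Finset.sum_range_zero]
    rw [lumpedMatrix_zero_zero, lumpedMatrix_apply (i := 0 + 1) (by omega) (by omega)]
    simp
    ring
  | succ j ih =>
    have h : QBDP.law (QBDP.lumpedMatrix a H) ν (k + 1) (j + 1)
        = ∑ q ∈ Finset.range (j + 3), QBDP.lumpedCoeff a H q *
          QBDP.law (QBDP.lumpedMatrix a H) ν k (j + 2 - q) := by
      rw [law_succ, ← Finset.sum_range_reflect]
      refine Finset.sum_congr rfl fun q hq => ?_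
      have hq := Finset.mem_range.1 hq
      rw [lumpedMatrix_apply (by omega) (by omega),
        show j + 1 + 1 - (j + 1 + 2 - 1 - q) = q by omega,
        show j + 1 + 2 - 1 - q = j + 2 - q by omega, mul_comm]
    rw [Finset.sum_range_succ, ih, h, lindley, lindley, Finset.sum_range_succ _ (j + 2),
      Finset.sum_range_succ _ (j + 2), ← add_assoc, ← Finset.sum_add_distrib]
    congr 1
    · refine Finset.sum_congr rfl fun q hq => ?_
      have hq := Finset.mem_range.1 hq
      rw [show j + 1 + 1 - q + 1 = (j + 1 - q + 1) + 1 by omega,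
        Finset.sum_range_succ _ (j + 1 - q + 1), show j + 2 - q = j + 1 - q + 1 by omega]
      ring
    · simp

theorem sum_law_eq_iterate (ν : ℕ → ℝ) (k : ℕ) :
    (fun j => ∑ i ∈ Finset.range (j + 1), QBDP.law (QBDP.lumpedMatrix a H) ν k i)
      = (lindley (QBDP.lumpedCoeff a H))^[k] (fun j => ∑ i ∈ Finset.range (j + 1), ν i) := by
  induction k with
  | zero => rfl
  | succ k ih =>
    rw [Function.iterate_succ_apply', ← ih]
    funext j
    exact sum_law_succ ν k j

end Chain

/-! ### The limiting distribution -/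

theorem theorem3 (a : ℕ → ℝ) (n H m : ℕ) (hH : 0 < H) (hHn : H ≤ n) (hm : m = n - H + 1)
    (ha_nonneg : ∀ i, 0 ≤ a i)
    (ha_sum : ∑ i ∈ Finset.range (n + 1), a i = 1)
    (ha_zero : ∀ i, n < i → a i = 0)
    (ha_n : a n ≠ 0)
    (ha_left : ∑ q ∈ Finset.range H, a q ≠ 0)
    (hW : QBDP.DistinctEigenvalues (QBDP.matW m 1 (QBDP.alpha a H))) :
    ∃ π : ℕ → ℝ,
      (∀ ν : ℕ → ℝ, (∀ i, 0 ≤ ν i) → HasSum ν 1 →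
        ∀ j, Tendsto (fun k => QBDP.law (QBDP.lumpedMatrix a H) ν k j) atTop (𝓝 (π j))) ∧
      π 0 = max (1 - ∑ j ∈ Finset.Icc 2 m, ((j : ℝ) - 1) * QBDP.alpha a H j) 0 ∧
      π 1 = (∑ j ∈ Finset.Icc 2 m, QBDP.alpha a H j) * π 0 ∧
      (∀ l : ℕ, 1 < l →
        π l = (1 + ∑ j ∈ Finset.Icc 2 m, QBDP.alpha a H j) * π (l - 1)
          - ∑ j ∈ Finset.Icc 2 (min m l), QBDP.alpha a H j * π (l - j)) ∧
      (∀ j, 0 ≤ π j) ∧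
      (∑ j ∈ Finset.Icc 2 m, ((j : ℝ) - 1) * QBDP.alpha a H j < 1 → HasSum π 1) ∧
      (1 ≤ ∑ j ∈ Finset.Icc 2 m, ((j : ℝ) - 1) * QBDP.alpha a H j → ∀ j, π j = 0) := by
  set c := QBDP.lumpedCoeff a H with hcdef
  have hm1 : 1 ≤ m := by omega
  have hc : ∀ q, 0 ≤ c q := by
    rintro (_ | q)
    · exact Finset.sum_nonneg fun i _ => ha_nonneg i
    · exact ha_nonneg _
  have hc0 : c 0 ≠ 0 := ha_left
  have hcm : ∀ q, m < q → c q = 0 := by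
    rintro (_ | q) hq
    · omega
    · exact ha_zero _ (by omega)
  have hsum : ∑ q ∈ Finset.range (m + 1), c q = 1 := by
    rw [Finset.sum_range_succ', add_comm, ← ha_sum, show n + 1 = H + m by omega,
      Finset.sum_range_add]
    rfl
  have hα : ∀ j, QBDP.alpha a H j = c j / c 0 := fun _ => rfl
  have hsplit := hsum
  rw [sum_range_succ_eq_add_sum_Icc _ hm1] at hsplit
  have hαsum : c 0 * ∑ j ∈ Finset.Icc 2 m, QBDP.alpha a H j = 1 - c 0 - c 1 := by
    simp only [hα]
    rw [← Finset.sum_div, mul_div_cancel₀ _ hc0]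
    linarith
  -- Total mass `1` replaces `1 - c 1` by `c 0` plus the tail sum, turning weights `q` into `q - 1`.
  have hdrift : 1 - ∑ q ∈ Finset.range (m + 1), q * c q
      = c 0 * (1 - ∑ j ∈ Finset.Icc 2 m, ((j : ℝ) - 1) * QBDP.alpha a H j) := by
    have h1 : c 0 * ∑ j ∈ Finset.Icc 2 m, ((j : ℝ) - 1) * QBDP.alpha a H j
        = ∑ j ∈ Finset.Icc 2 m, (j : ℝ) * c j - ∑ j ∈ Finset.Icc 2 m, c j := by
      rw [Finset.mul_sum, ← Finset.sum_sub_distrib]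
      refine Finset.sum_congr rfl fun j _ => ?_
      rw [hα]
      field_simp
    rw [mul_sub, h1, sum_range_succ_eq_add_sum_Icc _ hm1]
    push_cast
    linarith
  have hc0pos : 0 < c 0 := lt_of_le_of_ne (hc 0) hc0.symm
  obtain ⟨D, hfix, hmono, hD0, hD00, hlt, hge, hlim⟩ := exists_limit_iterate_lindley hc hc0 hcm hsum
  rw [hdrift] at hD00
  let π : ℕ → ℝ := fun j => j.casesOn (D 0) fun i => D (i + 1) - D i
  have hπsum : ∀ j, ∑ i ∈ Finset.range (j + 1), π i = D j := fun j => by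
    rw [Finset.sum_range_succ', Finset.sum_range_sub D j]
    exact sub_add_cancel _ _
  have hπ : ∀ j, 0 ≤ π j := by
    rintro (_ | j)
    · exact hD0 0
    · exact sub_nonneg.2 (hmono j.le_succ)
  refine ⟨π, fun ν hν hν1 => ?_, ?_, ?_, fun l hl => ?_, hπ, fun h => ?_, fun h j => ?_⟩
  · have hcdf : ∀ j, Tendsto (fun k => ∑ i ∈ Finset.range (j + 1),
        QBDP.law (QBDP.lumpedMatrix a H) ν k i) atTop (𝓝 (D j)) := fun j => by
      refine (hlim (fun j => ∑ i ∈ Finset.range (j + 1), ν i)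
        (fun j => Finset.sum_nonneg fun i _ => hν i)
        (fun j => sum_le_hasSum _ (fun i _ => hν i) hν1)
        (hν1.tendsto_sum_nat.comp (tendsto_add_atTop_nat 1)) j).congr fun k => ?_
      exact (congrFun (sum_law_eq_iterate ν k) j).symm
    rintro (_ | j)
    · exact (hcdf 0).congr fun k => by simp
    · refine ((hcdf (j + 1)).sub (hcdf j)).congr fun k => ?_
      rw [Finset.sum_range_succ, add_sub_cancel_left]
  · refine mul_left_cancel₀ hc0 (hD00.trans ?_)
    rw [mul_max_of_nonneg _ _ hc0pos.le, mul_zero]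
  · have h1 := congrFun hfix 0
    simp only [lindley, Finset.sum_range_succ, Finset.sum_range_zero] at h1
    refine mul_left_cancel₀ hc0 ?_
    rw [← mul_assoc, hαsum]
    change c 0 * (D 1 - D 0) = (1 - c 0 - c 1) * D 0
    simp at h1
    linarith
  · obtain ⟨l, rfl⟩ : ∃ k, l = k + 2 := ⟨l - 2, by omega⟩
    have h1 := fixedPoint_increment hfix l
    have h2 : ∑ q ∈ Finset.range (l + 2), c q * (D (l + 2 - q) - D (l + 1 - q)) + c (l + 2) * D 0
        = ∑ q ∈ Finset.range (l + 2 + 1), c q * π (l + 2 - q) := by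
      rw [Finset.sum_range_succ _ (l + 2), Nat.sub_self]
      congr 1
      refine Finset.sum_congr rfl fun q hq => ?_
      have := Finset.mem_range.1 hq
      rw [show l + 2 - q = l + 1 - q + 1 by omega]
    -- Isolating the terms `q = 0, 1` lets the balance equation at `l + 1` be solved for `π (l +
    -- 2)`.
    rw [h2, sum_range_succ_eq_add_sum_Icc _ (by omega)] at h1
    have h3 : ∑ q ∈ Finset.Icc 2 (l + 2), c q * π (l + 2 - q)
        = c 0 * ∑ j ∈ Finset.Icc 2 (min m (l + 2)), QBDP.alpha a H j * π (l + 2 - j) := by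
      rw [Finset.mul_sum]
      symm
      calc ∑ j ∈ Finset.Icc 2 (min m (l + 2)), c 0 * (QBDP.alpha a H j * π (l + 2 - j))
          = ∑ j ∈ Finset.Icc 2 (min m (l + 2)), c j * π (l + 2 - j) :=
            Finset.sum_congr rfl fun j _ => by rw [hα]; field_simp
        _ = _ := by
            refine Finset.sum_subset (Finset.Icc_subset_Icc_right (min_le_right _ _))
              fun q hq hq' => ?_
            rw [hcm q, zero_mul]
            simp only [Finset.mem_Icc] at hq hq'
            omega
    rw [h3] at h1
    refine mul_left_cancel₀ hc0 ?_
    rw [mul_sub (c 0) (_ * _), ← mul_assoc, mul_add, hαsum]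
    change π (l + 1) = _ at h1
    simp only [Nat.sub_zero, show l + 2 - 1 = l + 1 by omega] at h1 ⊢
    linarith
  · have h1 : ∑ q ∈ Finset.range (m + 1), q * c q < 1 := by
      have := mul_pos hc0pos (sub_pos.2 h)
      linarith
    rw [hasSum_iff_tendsto_nat_of_nonneg hπ, ← tendsto_add_atTop_iff_nat 1]
    simpa only [hπsum] using hlt h1
  · have h1 : 1 ≤ ∑ q ∈ Finset.range (m + 1), q * c q := by
      have := mul_nonpos_of_nonneg_of_nonpos hc0pos.le (sub_nonpos.2 h)
      linarith
    have h2 := hge h1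
    cases j with
    | zero => exact congrFun h2 0
    | succ j => simp [π, h2]
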